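/- Let $V\subset\mathbb C^n$ be an unbounded complex algebraic set, that is, an unbounded subset which is the common zero set of a family of polynomials in $\mathbb C[z_1,\dots,z_n]$. For a sequence $T=(t_j)_{j\in\mathbb N}$ of positive real numbers with $\lim_{j\to\infty}t_j=\infty$, let $$E_T(V)=\Big\{v\in\mathbb C^n : \text{there are } x_j\in V\ (j\in\mathbb N)\text{ with }\lim_{j\to\infty}\tfrac1{t_j}x_j=v\Big\}.$$ Then $V$ has a unique tangent cone at infinity, that is, the set $E_T(V)$ is the same for all such sequences $T$; this common set, denoted by $C_\infty(V)$, is a complex algebraic set; and $$\dim V=\dim C_\infty(V).$$ Here the dimension of an algebraic set $W\subset\mathbb C^n$ is its complex dimension, i.e. the Krull dimension of its coordinate ring $\mathbb C[z_1,\dots,z_n]/I(W)$, where $I(W)$ is the ideal of all polynomials vanishing on $W$. -/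

import Mathlib

open Filter Topology

/-- `V ⊆ ℂⁿ` is a complex algebraic set: the common zero locus of an ideal of polynomials. -/
def IsComplexAlgebraicSet {n : ℕ} (V : Set (Fin n → ℂ)) : Prop :=
  ∃ I : Ideal (MvPolynomial (Fin n) ℂ), V = MvPolynomial.zeroLocus ℂ I

/-- The (complex) dimension of an algebraic set `V ⊆ ℂⁿ`: the Krull dimension of its coordinate
ring `ℂ[z₁, …, zₙ] ⧸ I(V)`, where `I(V)` is the ideal of all polynomials vanishing on `V`. -/
noncomputable def algebraicSetDim {n : ℕ} (V : Set (Fin n → ℂ)) : WithBot ℕ∞ :=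
  ringKrullDim (MvPolynomial (Fin n) ℂ ⧸ MvPolynomial.vanishingIdeal ℂ V)

/-- `E_T(V)`: the set of vectors tangent to `V` at infinity with respect to the sequence
`T = (t_j)`, that is, the limits of `x_j / t_j` for sequences `(x_j)` in `V`.
(Limits in `ℂⁿ` do not depend on the choice of the norm.) -/
def tangentConeAtInfinity {n : ℕ} (t : ℕ → ℝ) (V : Set (Fin n → ℂ)) : Set (Fin n → ℂ) :=
  {v | ∃ x : ℕ → Fin n → ℂ, (∀ j, x j ∈ V) ∧ Tendsto (fun j => (1 / t j) • x j) atTop (𝓝 v)}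

/-- `C = C_∞(V)`: the set `V` has a unique tangent cone at infinity, and it is `C`. In other words,
`E_T(V) = C` for every sequence `T` of positive real numbers tending to infinity. Such sequences
exist, so that there is at most one such `C`. -/
def IsTheTangentConeAtInfinity {n : ℕ} (V C : Set (Fin n → ℂ)) : Prop :=
  ∀ t : ℕ → ℝ, (∀ j, 0 < t j) → Tendsto t atTop atTop → tangentConeAtInfinity t V = C

/-! Add a variable `s` and let `homogIdeal I` cut out a closed family whose slice at height `s ≠ 0`
is `s • V`; its slice at `0` is the cone. Limits of `(1 / t j) • x j` lie in that slice because the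
family is closed. For the converse, pass to a minimal prime `P` and take linear forms which,
together with `s`, make the homogenised coordinate ring finite over a polynomial ring and contain it
(`exists_linear_noether_normalization`). A finite dominant map to affine space is open
(`exists_tendsto_mem_zeroLocus`), so a point `v` over `(0, y)` is a limit of points over `(1 / t j,
y)`, and these rescale into `V`. For the dimension, the slices at `1` and `0` are both finite over,
and surject onto, the same affine space. -/

/-! ### Integral ring maps: dimension and lifting of points. -/

theorem ringKrullDim_eq_of_isIntegral_of_injective {A B : Type*} [CommRing A] [CommRing B]
    (f : A →+* B) (hf : f.IsIntegral) (hinj : Function.Injective f) :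
    ringKrullDim B = ringKrullDim A := by
  algebraize [f]
  have : Algebra.IsIntegral A B := ⟨hf⟩
  have : FaithfulSMul A B := (faithfulSMul_iff_algebraMap_injective A B).2 hinj
  apply le_antisymm
  · exact Order.krullDim_le_of_strictMono (PrimeSpectrum.comap (algebraMap A B))
      fun P Q h => Ideal.IsIntegral.comap_lt_comap (I := P.asIdeal) (J := Q.asIdeal) h
  · refine iSup_le fun l => ?_
    obtain ⟨Q, hQ, hQl⟩ := Ideal.nonempty_primesOver (S := B) (RelSeries.head l).asIdeal
    obtain ⟨L, hL, -⟩ := Ideal.exists_ltSeries_of_hasGoingUp l Q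
    rw [← hL]
    exact Order.LTSeries.length_le_krullDim L

namespace MvPolynomial

/-- Points of `zeroLocus ℂ I` lying over a point `ev` of the base of a finite morphism. -/
theorem exists_mem_zeroLocus_of_isIntegral {τ R : Type*} [Finite τ] [CommRing R]
    (I : Ideal (MvPolynomial τ ℂ)) (φ : R →+* MvPolynomial τ ℂ ⧸ I) (hφ : φ.IsIntegral)
    (ev : R →+* ℂ) (hev : Function.Surjective ev) (hker : RingHom.ker φ ≤ RingHom.ker ev)
    (hC : ∀ z : ℂ, ∃ r, ev r = z ∧ φ r = Ideal.Quotient.mk I (C z)) :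
    ∃ x ∈ zeroLocus ℂ I, ∀ r p, φ r = Ideal.Quotient.mk I p → ev r = aeval x p := by
  let := φ.toAlgebra
  have : Algebra.IsIntegral R (MvPolynomial τ ℂ ⧸ I) := ⟨hφ⟩
  have := RingHom.ker_isMaximal_of_surjective ev hev
  obtain ⟨Q, hQ, hQ'⟩ := Ideal.exists_ideal_over_maximal_of_isIntegral
    (S := MvPolynomial τ ℂ ⧸ I) (RingHom.ker ev) hker
  have hM := Ideal.comap_isMaximal_of_surjective (Ideal.Quotient.mk I)
    Ideal.Quotient.mk_surjective (K := Q)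
  obtain ⟨x, hx⟩ := isMaximal_iff_eq_vanishingIdeal_singleton.1 hM
  have hmem (p) (hp : Ideal.Quotient.mk I p ∈ Q) : aeval x p = 0 := by
    rw [← mem_vanishingIdeal_singleton_iff, ← hx]
    exact hp
  refine ⟨x, fun p hp => hmem p ?_, fun r p h => ?_⟩
  · rw [Ideal.Quotient.eq_zero_iff_mem.2 hp]
    exact Q.zero_mem
  -- Subtracting a constant with the same value puts `r` into `ker ev`, the contraction of `Q`.
  · obtain ⟨r', hr', hφr'⟩ := hC (ev r)
    have h1 : r - r' ∈ RingHom.ker ev := by simp [RingHom.mem_ker, hr']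
    rw [← hQ', Ideal.mem_comap] at h1
    have h2 : φ (r - r') ∈ Q := h1
    rw [map_sub, h, hφr', ← map_sub] at h2
    have := hmem _ h2
    rw [map_sub, sub_eq_zero] at this
    simpa using this.symm

/-- The integral closure of `A` in `R` contains every `f (X i)`, so `f` factors through it and `R`
is integral over it. -/
theorem isIntegral_of_forall_isIntegralElem {σ A R : Type*} [CommRing A] [Algebra ℂ A]
    [CommRing R] [Algebra ℂ R] {f : MvPolynomial σ ℂ →ₐ[ℂ] R} (hf : f.toRingHom.IsIntegral)
    {g : A →ₐ[ℂ] R} (h : ∀ i, g.toRingHom.IsIntegralElem (f (X i))) :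
    g.toRingHom.IsIntegral := by
  let := g.toRingHom.toAlgebra
  let K := integralClosure A R
  let f' : MvPolynomial σ ℂ →+* K :=
    eval₂Hom ((algebraMap A K).comp (algebraMap ℂ A)) fun i => ⟨f (X i), h i⟩
  have hcomp : (K.val.toRingHom).comp f' = f.toRingHom := by
    apply ringHom_ext
    · intro r
      have h1 : f' (C r) = algebraMap A K (algebraMap ℂ A r) := by simp [f']
      have h2 : K.val.toRingHom (algebraMap A K (algebraMap ℂ A r)) = g (algebraMap ℂ A r) := rfl
      rw [RingHom.comp_apply, h1, h2, AlgHom.commutes]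
      exact (f.commutes r).symm
    · intro i
      have h1 : f' (X i) = ⟨f (X i), h i⟩ := by simp [f']
      rw [RingHom.comp_apply, h1]
      rfl
  have h1 : K.val.toRingHom.IsIntegral := by
    rw [← hcomp] at hf
    exact RingHom.IsIntegral.tower_top _ _ hf
  have h2 : (algebraMap A K).IsIntegral := algebraMap_isIntegral_iff.2 inferInstance
  exact RingHom.IsIntegral.trans _ _ h2 h1

end MvPolynomial

/-! ### Roots of monic polynomials with varying coefficients. -/

theorem Multiset.pow_card_le_norm_prod_sub (s : Multiset ℂ) (z : ℂ) {ε : ℝ} (hε : 0 ≤ ε)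
    (h : ∀ r ∈ s, ε ≤ ‖z - r‖) : ε ^ s.card ≤ ‖(s.map fun r => z - r).prod‖ := by
  induction s using Multiset.induction_on with
  | empty => simp
  | cons a s ih =>
    rw [Multiset.map_cons, Multiset.prod_cons, norm_mul, Multiset.card_cons, pow_succ']
    exact mul_le_mul (h a (by simp)) (ih fun r hr => h r (by simp [hr])) (by positivity)
      (norm_nonneg _)

/-- `‖F z‖` is the product of the distances from `z` to the roots; take a nearest root. -/
theorem Polynomial.Monic.exists_isRoot_norm_sub_pow_le {F : Polynomial ℂ} (hF : F.Monic)
    (hd : F.natDegree ≠ 0) (z : ℂ) :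
    ∃ r, F.IsRoot r ∧ ‖z - r‖ ^ F.natDegree ≤ ‖F.eval z‖ := by
  have hs : F.Splits := IsAlgClosed.splits F
  have hcard := hs.natDegree_eq_card_roots
  have hne : F.roots.toFinset.Nonempty := by
    rw [Finset.nonempty_iff_ne_empty, Ne, Multiset.toFinset_eq_empty]
    intro h
    rw [h] at hcard
    exact hd hcard
  obtain ⟨r, hr, hmin⟩ := F.roots.toFinset.exists_min_image (fun r => ‖z - r‖) hne
  refine ⟨r, Polynomial.isRoot_of_mem_roots (Multiset.mem_toFinset.1 hr), ?_⟩
  rw [hs.eval_eq_prod_roots_of_monic hF, hcard]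
  exact Multiset.pow_card_le_norm_prod_sub _ _ (norm_nonneg _)
    fun r' hr' => hmin r' (Multiset.mem_toFinset.2 hr')

namespace MvPolynomial

variable {σ τ : Type*}

theorem continuous_eval_map_eval (F : Polynomial (MvPolynomial σ ℂ)) (z : ℂ) :
    Continuous fun w : σ → ℂ => (F.map (eval w)).eval z := by
  simp only [Polynomial.eval_map, Polynomial.eval₂_eq_sum, Polynomial.sum]
  exact continuous_finsetSum _ fun i _ => (continuous_eval _).mul continuous_const

/-- The roots of a monic polynomial depend continuously on its coefficients. -/
theorem exists_tendsto_root {F : Polynomial (MvPolynomial σ ℂ)} (hF : F.Monic)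
    {w : ℕ → σ → ℂ} {w₀ : σ → ℂ} (hw : Tendsto w atTop (𝓝 w₀)) {z₀ : ℂ}
    (hz₀ : (F.map (eval w₀)).eval z₀ = 0) :
    ∃ z : ℕ → ℂ, (∀ j, (F.map (eval (w j))).eval (z j) = 0) ∧ Tendsto z atTop (𝓝 z₀) := by
  have hdeg (w : σ → ℂ) : (F.map (eval w)).natDegree = F.natDegree := hF.natDegree_map _
  have hd : F.natDegree ≠ 0 := by
    intro h
    rw [hF.natDegree_eq_zero.1 h] at hz₀
    simp at hz₀
  choose z hz hle using fun j =>
    (hF.map (eval (w j))).exists_isRoot_norm_sub_pow_le (by rwa [hdeg]) z₀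
  refine ⟨z, hz, ?_⟩
  have h1 : Tendsto (fun j => ‖(F.map (eval (w j))).eval z₀‖) atTop (𝓝 0) := by
    have := ((continuous_eval_map_eval F z₀).tendsto w₀).comp hw
    rw [hz₀] at this
    simpa using this.norm
  have h2 : Tendsto (fun j => ‖z₀ - z j‖ ^ F.natDegree) atTop (𝓝 0) :=
    squeeze_zero (fun j => by positivity) (fun j => by simpa [hdeg] using hle j) h1
  rw [tendsto_iff_norm_sub_tendsto_zero]
  rw [Metric.tendsto_atTop] at h2 ⊢
  intro ε hε
  obtain ⟨N, hN⟩ := h2 (ε ^ F.natDegree) (by positivity)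
  refine ⟨N, fun j hj => ?_⟩
  have := hN j hj
  rw [dist_zero_right, Real.norm_of_nonneg (by positivity)] at this ⊢
  rw [norm_sub_rev]
  exact lt_of_pow_lt_pow_left₀ _ hε.le this

/-- The Cauchy bound is dominated by a continuous function of `w`, which is bounded along a
convergent sequence. -/
theorem exists_norm_root_le {G : Polynomial (MvPolynomial σ ℂ)} (hG : G.Monic)
    {w : ℕ → σ → ℂ} {w₀ : σ → ℂ} (hw : Tendsto w atTop (𝓝 w₀)) :
    ∃ B : ℝ, ∀ j z, (G.map (eval (w j))).eval z = 0 → ‖z‖ ≤ B := by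
  let b (w : σ → ℂ) : ℝ := 1 + ∑ i ∈ Finset.range G.natDegree, ‖eval w (G.coeff i)‖
  have hb : Continuous b := continuous_const.add
    (continuous_finsetSum _ fun i _ => (continuous_eval _).norm)
  obtain ⟨B, hB⟩ := ((hb.tendsto w₀).comp hw).bddAbove_range
  refine ⟨B, fun j z hz => le_trans ?_ (hB ⟨j, rfl⟩)⟩
  have hm := hG.map (eval (w j))
  have h1 := Polynomial.IsRoot.norm_lt_cauchyBound hm.ne_zero hz
  refine (NNReal.coe_le_coe.2 h1.le).trans ?_
  have h2 : (G.map (eval (w j))).cauchyBound ≤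
      ∑ i ∈ Finset.range G.natDegree, ‖eval (w j) (G.coeff i)‖₊ + 1 := by
    rw [Polynomial.cauchyBound, hm.leadingCoeff, hG.natDegree_map]
    simp only [nnnorm_one, div_one, Polynomial.coeff_map]
    gcongr
    exact Finset.sup_le fun i hi => Finset.single_le_sum
      (f := fun i => ‖eval (w j) (G.coeff i)‖₊) (fun _ _ => zero_le) hi
  refine (NNReal.coe_le_coe.2 h2).trans_eq ?_
  simp [b, add_comm]

/-! ### Openness of finite dominant maps to affine space. -/

theorem eval_map_eval_eq_zero {I : Ideal (MvPolynomial τ ℂ)}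
    {Φ : MvPolynomial σ ℂ →ₐ[ℂ] MvPolynomial τ ℂ} {q : Polynomial (MvPolynomial σ ℂ)}
    {g : MvPolynomial τ ℂ}
    (hq : q.eval₂ ((Ideal.Quotient.mk I).comp Φ.toRingHom) (Ideal.Quotient.mk I g) = 0)
    {x : τ → ℂ} (hx : x ∈ zeroLocus ℂ I) {w : σ → ℂ} (hw : ∀ i, aeval x (Φ (X i)) = w i) :
    (q.map (eval w)).eval (aeval x g) = 0 := by
  rw [← Polynomial.hom_eval₂, Ideal.Quotient.eq_zero_iff_mem] at hq
  have h := hx _ hq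
  have hc : ((aeval x : MvPolynomial τ ℂ →ₐ[ℂ] ℂ).toRingHom).comp Φ.toRingHom = eval w := by
    apply ringHom_ext
    · intro r
      have : Φ (C r) = C r := Φ.commutes r
      simp [this]
    · intro i
      simpa using hw i
  rw [← hc, Polynomial.eval_map]
  have h' : (aeval x : MvPolynomial τ ℂ →ₐ[ℂ] ℂ).toRingHom (q.eval₂ Φ.toRingHom g) = 0 := h
  rw [Polynomial.hom_eval₂] at h'
  exact h'

/-- A finite dominant morphism from an irreducible variety to an affine space is open. -/
theorem exists_tendsto_mem_zeroLocus [Finite τ] (P : Ideal (MvPolynomial τ ℂ)) [P.IsPrime]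
    (Φ : MvPolynomial σ ℂ →ₐ[ℂ] MvPolynomial τ ℂ)
    (hint : ((Ideal.Quotient.mk P).comp Φ.toRingHom).IsIntegral)
    (hinj : Function.Injective ((Ideal.Quotient.mk P).comp Φ.toRingHom))
    {x₀ : τ → ℂ} (hx₀ : x₀ ∈ zeroLocus ℂ P) {w : ℕ → σ → ℂ} {w₀ : σ → ℂ}
    (hw : Tendsto w atTop (𝓝 w₀)) (hxw₀ : ∀ i, aeval x₀ (Φ (X i)) = w₀ i) :
    ∃ x : ℕ → τ → ℂ, (∀ j, x j ∈ zeroLocus ℂ P) ∧ (∀ j i, aeval (x j) (Φ (X i)) = w j i) ∧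
      Tendsto x atTop (𝓝 x₀) := by
  have := Fintype.ofFinite τ
  set f := (Ideal.Quotient.mk P).comp Φ.toRingHom with hf
  choose G hGm hG using fun i : τ => hint (Ideal.Quotient.mk P (X i))
  have hGx {x : τ → ℂ} (hx : x ∈ zeroLocus ℂ P) {w : σ → ℂ}
      (hw : ∀ i, aeval x (Φ (X i)) = w i) (i : τ) : ((G i).map (eval w)).eval (x i) = 0 := by
    simpa using eval_map_eval_eq_zero (hG i) hx hw
  choose u hu hu' using fun i : τ =>
    Polynomial.exists_eq_pow_rootMultiplicity_mul_and_not_dvd _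
      ((hGm i).map (eval w₀)).ne_zero (x₀ i)
  -- `u i` carries the roots of `G i` over `w₀` other than `x₀ i`. Hence `g` is nonzero at `x₀` and
  -- vanishes at every other point of the fibre over `w₀`.
  let g : MvPolynomial τ ℂ := ∏ i, Polynomial.aeval (X i) (u i)
  have hg (x : τ → ℂ) : aeval x g = ∏ i, (u i).eval (x i) := by
    simp only [g, map_prod, ← Polynomial.aeval_algHom_apply, aeval_X]
    rfl
  have hg₀ : aeval x₀ g ≠ 0 := by
    rw [hg, Finset.prod_ne_zero_iff]
    exact fun i _ h => hu' i (Polynomial.dvd_iff_isRoot.2 h)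
  let := f.toAlgebra
  have : FaithfulSMul (MvPolynomial σ ℂ) (MvPolynomial τ ℂ ⧸ P) :=
    (faithfulSMul_iff_algebraMap_injective _ _).2 hinj
  have hgi : IsIntegral (MvPolynomial σ ℂ) (Ideal.Quotient.mk P g) := hint _
  set F := minpoly (MvPolynomial σ ℂ) (Ideal.Quotient.mk P g)
  have hF0 : F.eval₂ f (Ideal.Quotient.mk P g) = 0 := 
    minpoly.aeval (MvPolynomial σ ℂ) (Ideal.Quotient.mk P g)
  obtain ⟨z, hz, hzlim⟩ := exists_tendsto_root (minpoly.monic hgi) hw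
    (eval_map_eval_eq_zero hF0 hx₀ hxw₀)
  have hex (j : ℕ) : ∃ x ∈ zeroLocus ℂ P, (∀ i, aeval x (Φ (X i)) = w j i) ∧
      aeval x g = z j := by
    obtain ⟨x, hx, hx'⟩ := exists_mem_zeroLocus_of_isIntegral P
      (Polynomial.eval₂RingHom f (Ideal.Quotient.mk P g))
      (RingHom.IsIntegral.tower_top Polynomial.C _ (by
        have hc : (Polynomial.eval₂RingHom f (Ideal.Quotient.mk P g)).comp Polynomial.C = f :=
          RingHom.ext fun r => Polynomial.eval₂_C _ _
        rwa [hc]))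
      (Polynomial.eval₂RingHom (eval (w j)) (z j))
      (fun c => ⟨Polynomial.C (C c), by simp⟩)
      (by
        intro p hp
        -- The polynomial ring is integrally closed, so all relations satisfied by `g` are multiples
        -- of `F`; hence each root `z j` is a value of `g` on the fibre over `w j`.
        obtain ⟨q, rfl⟩ := minpoly.isIntegrallyClosed_dvd hgi (p := p) hp
        rw [RingHom.mem_ker, map_mul]
        have := hz j
        rw [Polynomial.eval_map] at this
        rw [Polynomial.coe_eval₂RingHom, this, zero_mul])
      (fun c => ⟨Polynomial.C (C c), by simp, by
        have : Φ (C c) = C c := Φ.commutes c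
        simp [f, this]⟩)
    refine ⟨x, hx, fun i => ?_, ?_⟩
    · rw [← hx' (Polynomial.C (X i)) (Φ (X i)) (by simp [f])]
      simp
    · rw [← hx' Polynomial.X g (by simp)]
      simp
  choose x hx hxw hxg using hex
  refine ⟨x, hx, hxw, ?_⟩
  choose B hB using fun i => exists_norm_root_le (hGm i) hw
  have hbdd (j : ℕ) : x j ∈ Metric.closedBall (0 : τ → ℂ) (∑ i, |B i|) := by
    rw [mem_closedBall_zero_iff, pi_norm_le_iff_of_nonneg (by positivity)]
    exact fun i => ((hB i j _ (hGx (hx j) (hxw j) i)).trans (le_abs_self _)).trans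
      (Finset.single_le_sum (f := fun i => |B i|) (fun _ _ => abs_nonneg _) (Finset.mem_univ i))
  -- By compactness it suffices to identify subsequential limits `y`: they lie over `w₀` and satisfy
  -- `g y = g x₀ ≠ 0`, which forces `y = x₀`.
  refine tendsto_of_subseq_tendsto fun ns hns => ?_
  obtain ⟨y, -, ms, hms, hy⟩ := tendsto_subseq_of_bounded Metric.isBounded_closedBall
    fun j => hbdd (ns j)
  refine ⟨ms, ?_⟩
  have hsub : Tendsto (fun j => ns (ms j)) atTop atTop := hns.comp hms.tendsto_atTop
  have hcont (p : MvPolynomial τ ℂ) : Tendsto (fun j => aeval (x (ns (ms j))) p) atTop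
      (𝓝 (aeval y p)) := by
    exact ((continuous_eval p).tendsto y).comp hy
  have hyP : y ∈ zeroLocus ℂ P := fun p hp => tendsto_nhds_unique (hcont p)
    (by simpa only [hx _ p hp] using tendsto_const_nhds)
  have hyw (i : σ) : aeval y (Φ (X i)) = w₀ i := tendsto_nhds_unique (hcont _) (by
    simp only [hxw]
    exact ((continuous_apply i).tendsto w₀).comp (hw.comp hsub))
  have hyg : aeval y g = aeval x₀ g := tendsto_nhds_unique (hcont g) (by
    simp only [hxg]
    exact hzlim.comp hsub)
  rw [← hyg, hg, Finset.prod_ne_zero_iff] at hg₀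
  have : y = x₀ := by
    funext i
    have h := hGx hyP hyw i
    rw [hu i, Polynomial.eval_mul, Polynomial.eval_pow] at h
    have h' := eq_zero_of_pow_eq_zero
      ((mul_eq_zero.1 h).resolve_right (hg₀ i (Finset.mem_univ i)))
    simpa [sub_eq_zero] using h'
  rwa [this] at hy

end MvPolynomial

/-! ### Homogenisation and the slices of its zero locus. -/

namespace MvPolynomial

variable {σ : Type*}

/-- The substitution `s ↦ s`, `zᵢ ↦ s zᵢ`, where `none` indexes the homogenising variable `s`. -/
noncomputable def scaleHom (σ : Type*) :
    MvPolynomial (Option σ) ℂ →ₐ[ℂ] Polynomial (MvPolynomial σ ℂ) :=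
  aeval fun o => o.elim Polynomial.X fun i => Polynomial.C (X i) * Polynomial.X

/-- The homogenisation of an ideal: the polynomials `g(s, z)` for which all coefficients of
`g(s, s z)` with respect to `s` lie in `I`. -/
noncomputable def homogIdeal (I : Ideal (MvPolynomial σ ℂ)) : Ideal (MvPolynomial (Option σ) ℂ) :=
  (I.map Polynomial.C).comap (scaleHom σ)

theorem mem_homogIdeal {I : Ideal (MvPolynomial σ ℂ)} {g : MvPolynomial (Option σ) ℂ} :
    g ∈ homogIdeal I ↔ ∀ k, (scaleHom σ g).coeff k ∈ I :=
  Ideal.mem_map_C_iff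

instance (P : Ideal (MvPolynomial σ ℂ)) [P.IsPrime] : (homogIdeal P).IsPrime := by
  have : (P.map (Polynomial.C : MvPolynomial σ ℂ →+* _)).IsPrime :=
    Ideal.isPrime_map_C_of_isPrime
  exact Ideal.comap_isPrime _ _

@[simp]
theorem scaleHom_X_none : scaleHom σ (X none) = Polynomial.X := by simp [scaleHom]

@[simp]
theorem scaleHom_X_some (i : σ) :
    scaleHom σ (X (some i)) = Polynomial.C (X i) * Polynomial.X := by simp [scaleHom]

theorem eval_scaleHom (g : MvPolynomial (Option σ) ℂ) (v : σ → ℂ) (s : ℂ) :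
    ((scaleHom σ g).map (eval v)).eval s = aeval (fun o : Option σ => o.elim s (s • v)) g := by
  induction g using MvPolynomial.induction_on with
  | C c =>
    have : scaleHom σ (C c) = Polynomial.C (C c) := (scaleHom σ).commutes c
    simp [this]
  | add p q hp hq => simp [hp, hq]
  | mul_X p o hp =>
    cases o with
    | none => simp [hp]
    | some i =>
      simp only [map_mul, hp, scaleHom_X_some, Polynomial.map_mul, Polynomial.map_C, eval_X,
        Polynomial.map_X, Polynomial.eval_mul, Polynomial.eval_C, Polynomial.eval_X, aeval_X,
        Option.elim_some, Pi.smul_apply, smul_eq_mul]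
      ring

theorem scaleHom_rename_some {p : MvPolynomial σ ℂ} {m : ℕ} (hp : p.IsHomogeneous m) :
    scaleHom σ (rename some p) = Polynomial.X ^ m * Polynomial.C p := by
  have h1 : scaleHom σ (rename some p) =
      ∑ d ∈ p.support, scaleHom σ (rename some (monomial d (p.coeff d))) := by
    conv_lhs => rw [p.as_sum, map_sum, map_sum]
  have h2 (d) (hd : d ∈ p.support) : scaleHom σ (rename some (monomial d (p.coeff d))) =
      Polynomial.X ^ m * Polynomial.C (monomial d (p.coeff d)) := by
    have hdeg : Finsupp.degree d = m :=
      (DFunLike.congr_fun Finsupp.degree_eq_weight_one d).trans (hp (mem_support_iff.1 hd))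
    rw [monomial_eq, map_mul, map_mul, rename_C, map_mul]
    have : scaleHom σ (C (p.coeff d)) = Polynomial.C (C (p.coeff d)) := (scaleHom σ).commutes _
    rw [this, Finsupp.prod, map_prod, map_prod, map_prod]
    simp only [map_pow, rename_X, scaleHom_X_some, mul_pow, Finset.prod_mul_distrib,
      Finset.prod_pow_eq_pow_sum]
    rw [← hdeg, Finsupp.degree_apply]
    ring
  rw [h1, Finset.sum_congr rfl h2, ← Finset.mul_sum, ← map_sum, ← p.as_sum]

/-- The homogenisation of a polynomial. -/
noncomputable def homogenization (p : MvPolynomial σ ℂ) : MvPolynomial (Option σ) ℂ :=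
  ∑ m ∈ Finset.range (p.totalDegree + 1),
    X none ^ (p.totalDegree - m) * rename some (homogeneousComponent m p)

theorem scaleHom_homogenization (p : MvPolynomial σ ℂ) :
    scaleHom σ (homogenization p) = Polynomial.X ^ p.totalDegree * Polynomial.C p := by
  have h (m) (hm : m ∈ Finset.range (p.totalDegree + 1)) :
      scaleHom σ (X none ^ (p.totalDegree - m) * rename some (homogeneousComponent m p)) =
        Polynomial.X ^ p.totalDegree * Polynomial.C (homogeneousComponent m p) := by
    rw [map_mul, map_pow, scaleHom_X_none,
      scaleHom_rename_some (homogeneousComponent_isHomogeneous m p), ← mul_assoc, ← pow_add,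
      Nat.sub_add_cancel (Finset.mem_range_succ_iff.1 hm)]
  rw [homogenization, map_sum, Finset.sum_congr rfl h, ← Finset.mul_sum, ← map_sum,
    sum_homogeneousComponent]

theorem homogenization_mem_homogIdeal {I : Ideal (MvPolynomial σ ℂ)} {p : MvPolynomial σ ℂ}
    (hp : p ∈ I) : homogenization p ∈ homogIdeal I := by
  rw [homogIdeal, Ideal.mem_comap, scaleHom_homogenization]
  exact Ideal.mul_mem_left _ _ (Ideal.mem_map_of_mem _ hp)

theorem elim_smul_mem_zeroLocus {I : Ideal (MvPolynomial σ ℂ)} {v : σ → ℂ}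
    (hv : v ∈ zeroLocus ℂ I) (s : ℂ) :
    (fun o : Option σ => o.elim s (s • v)) ∈ zeroLocus ℂ (homogIdeal I) := by
  intro g hg
  rw [← eval_scaleHom]
  have : (scaleHom σ g).map (eval v) = 0 := by
    ext k
    simpa using hv _ (mem_homogIdeal.1 hg k)
  simp [this]

theorem mem_zeroLocus_of_elim_smul {I : Ideal (MvPolynomial σ ℂ)} {v : σ → ℂ} {s : ℂ}
    (hs : s ≠ 0)
    (h : (fun o : Option σ => o.elim s (s • v)) ∈ zeroLocus ℂ (homogIdeal I)) :
    v ∈ zeroLocus ℂ I := by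
  intro p hp
  have := h _ (homogenization_mem_homogIdeal hp)
  rw [← eval_scaleHom, scaleHom_homogenization] at this
  simpa [hs] using this

theorem scaleHom_injective [Finite σ] : Function.Injective (scaleHom σ) := by
  rw [injective_iff_map_eq_zero]
  intro g hg
  -- The points `(s, s • v)` fill the set `s ≠ 0`; the factor `X none` takes care of `s = 0`.
  have h : X none * g = 0 := by
    apply MvPolynomial.funext
    intro x
    rw [map_mul, eval_X, map_zero]
    by_cases hx : x none = 0
    · simp [hx]
    · have := eval_scaleHom g (fun i => (x none)⁻¹ * x (some i)) (x none)
      have hx' : (fun o : Option σ => o.elim (x none)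
          (x none • fun i => (x none)⁻¹ * x (some i))) = x := by
        funext o
        cases o with
        | none => rfl
        | some i => simp [hx]
      rw [hx', hg] at this
      simpa using Or.inr this.symm
  exact (mul_eq_zero.1 h).resolve_left (X_ne_zero _)

theorem isClosed_zeroLocus (I : Ideal (MvPolynomial σ ℂ)) :
    IsClosed (zeroLocus ℂ I : Set (σ → ℂ)) := by
  have : (zeroLocus ℂ I : Set (σ → ℂ)) = ⋂ p ∈ I, {x | eval x p = 0} := by
    ext x
    simp
  rw [this]
  exact isClosed_biInter fun p _ => isClosed_eq (continuous_eval p) continuous_const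

/-- The slice at height `s` of the zero locus of the homogenised ideal. -/
def slice (I : Ideal (MvPolynomial σ ℂ)) (s : ℂ) : Set (σ → ℂ) :=
  {v | (fun o : Option σ => o.elim s v) ∈ zeroLocus ℂ (homogIdeal I)}

theorem slice_one (I : Ideal (MvPolynomial σ ℂ)) : slice I 1 = zeroLocus ℂ I := by
  ext v
  refine ⟨fun h => mem_zeroLocus_of_elim_smul one_ne_zero ?_, fun h => ?_⟩
  · simpa only [one_smul] using! h
  · simpa only [one_smul] using! elim_smul_mem_zeroLocus h 1

/-- Setting the homogenising variable equal to `s`. -/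
noncomputable def dehomogHom (σ : Type*) (s : ℂ) :
    MvPolynomial (Option σ) ℂ →ₐ[ℂ] MvPolynomial σ ℂ :=
  aeval fun o => o.elim (C s) X

theorem aeval_dehomogHom (s : ℂ) (v : σ → ℂ) (g : MvPolynomial (Option σ) ℂ) :
    aeval v (dehomogHom σ s g) = aeval (fun o : Option σ => o.elim s v) g := by
  have : (aeval v : MvPolynomial σ ℂ →ₐ[ℂ] ℂ).comp (dehomogHom σ s) =
      aeval (fun o : Option σ => o.elim s v) := by
    ext o
    cases o <;> simp [dehomogHom]
  exact DFunLike.congr_fun this g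

theorem slice_eq_zeroLocus (I : Ideal (MvPolynomial σ ℂ)) (s : ℂ) :
    slice I s = zeroLocus ℂ ((homogIdeal I).map (dehomogHom σ s)) := by
  ext v
  rw [Ideal.map, zeroLocus_span]
  simp only [slice, Set.mem_ofPred_eq, mem_zeroLocus_iff, Set.forall_mem_image, SetLike.mem_coe]
  exact forall₂_congr fun g _ => by rw [← aeval_dehomogHom]

/-- A point of the slice at height `0` of the homogenisation of a radical ideal lies in
the slice of one of the minimal primes. -/
theorem exists_minimalPrimes_mem_slice [Finite σ] {I : Ideal (MvPolynomial σ ℂ)}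
    (hI : I.IsRadical) {s : ℂ} {v : σ → ℂ} (hv : v ∈ slice I s) :
    ∃ P ∈ I.minimalPrimes, v ∈ slice P s := by
  by_contra! h
  have h' (P : I.minimalPrimes) :
      ∃ g ∈ homogIdeal P.1, aeval (fun o : Option σ => o.elim s v) g ≠ 0 := by
    simpa [slice] using h P.1 P.2
  choose g hg hgv using h'
  have := (Ideal.finite_minimalPrimes_of_isNoetherianRing _ I).fintype
  have hcoeff (P : I.minimalPrimes) (k : ℕ) : (scaleHom σ (∏ P, g P)).coeff k ∈ P.1 := by
    have hP : ∏ P, g P ∈ homogIdeal P.1 :=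
      Ideal.mem_of_dvd _ (Finset.dvd_prod_of_mem g (Finset.mem_univ P)) (hg P)
    exact mem_homogIdeal.1 hP k
  -- The coefficients lie in every minimal prime, hence in their intersection, which is the radical
  -- ideal `I`.
  have hmem : ∏ P, g P ∈ homogIdeal I := by
    rw [mem_homogIdeal]
    intro k
    suffices h : (scaleHom σ (∏ P, g P)).coeff k ∈ sInf I.minimalPrimes by
      rwa [Ideal.sInf_minimalPrimes, hI.radical] at h
    refine Ideal.mem_sInf.2 fun {P} hP => ?_
    exact hcoeff ⟨P, hP⟩ k
  have := hv _ hmem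
  rw [map_prod, Finset.prod_eq_zero_iff] at this
  obtain ⟨P, -, hP⟩ := this
  exact hgv P hP

end MvPolynomial

/-! ### Noether normalisation by linear forms. -/

theorem Polynomial.natDegree_le_and_coeff_prod_pow {ι R : Type*} [CommRing R] (s : Finset ι)
    (f : ι → Polynomial R) (d : ι → ℕ) (hf : ∀ i, (f i).natDegree ≤ 1) :
    (∏ i ∈ s, f i ^ d i).natDegree ≤ ∑ i ∈ s, d i ∧
      (∏ i ∈ s, f i ^ d i).coeff (∑ i ∈ s, d i) = ∏ i ∈ s, (f i).coeff 1 ^ d i := by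
  classical
  induction s using Finset.induction_on with
  | empty => simp
  | insert i s hi ih =>
    have h1 : (f i ^ d i).natDegree ≤ d i := by
      simpa using Polynomial.natDegree_pow_le_of_le (d i) (hf i)
    rw [Finset.prod_insert hi, Finset.sum_insert hi, Finset.prod_insert hi]
    refine ⟨Polynomial.natDegree_mul_le_of_le h1 ih.1, ?_⟩
    rw [Polynomial.coeff_mul_add_eq_of_natDegree_le h1 ih.1, ih.2]
    congr 1
    simpa using Polynomial.coeff_pow_of_natDegree_le (m := d i) (hf i)

namespace MvPolynomial

/-- Only the linear coefficients of the `f i` reach degree `m`. This provides the leading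
coefficient of the integral equation used in the normalisation. -/
theorem natDegree_aeval_le_and_coeff {ι R : Type*} [CommRing R] [Algebra ℂ R]
    {q : MvPolynomial ι ℂ} {m : ℕ} (hq : q.IsHomogeneous m) (f : ι → Polynomial R)
    (hf : ∀ i, (f i).natDegree ≤ 1) (a : ι → ℂ) (ha : ∀ i, (f i).coeff 1 = algebraMap ℂ R (a i)) :
    (aeval f q).natDegree ≤ m ∧ (aeval f q).coeff m = algebraMap ℂ R (eval a q) := by
  have hsum : aeval f q = ∑ d ∈ q.support,
      Polynomial.C (algebraMap ℂ R (q.coeff d)) * ∏ i ∈ d.support, f i ^ d i := by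
    rw [aeval_def, eval₂_eq]
    rfl
  have hdeg (d) (hd : d ∈ q.support) : ∑ i ∈ d.support, d i = m := by
    rw [← Finsupp.degree_apply]
    exact (DFunLike.congr_fun Finsupp.degree_eq_weight_one d).trans (hq (mem_support_iff.1 hd))
  have hterm (d) (hd : d ∈ q.support) :
      (∏ i ∈ d.support, f i ^ d i).natDegree ≤ m ∧
        (∏ i ∈ d.support, f i ^ d i).coeff m = ∏ i ∈ d.support, (f i).coeff 1 ^ d i := by
    have := Polynomial.natDegree_le_and_coeff_prod_pow d.support f d hf
    rwa [hdeg d hd] at this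
  constructor
  · rw [hsum]
    exact Polynomial.natDegree_sum_le_of_forall_le _ _ fun d hd =>
      (Polynomial.natDegree_C_mul_le _ _).trans (hterm d hd).1
  · rw [hsum, Polynomial.finsetSum_coeff, eval_eq, map_sum]
    refine Finset.sum_congr rfl fun d hd => ?_
    rw [Polynomial.coeff_C_mul, (hterm d hd).2]
    simp [ha]

variable {κ σ : Type*} [Fintype σ]

/-- The substitution of linear forms for the variables. -/
noncomputable def linHom (c : κ → σ → ℂ) : MvPolynomial κ ℂ →ₐ[ℂ] MvPolynomial σ ℂ :=
  aeval fun i => ∑ j, C (c i j) * X j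

/-- The substitution of linear forms for the variables, which fixes the homogenising variable. -/
noncomputable def linHomOption (c : κ → σ → ℂ) :
    MvPolynomial (Option κ) ℂ →ₐ[ℂ] MvPolynomial (Option σ) ℂ :=
  aeval fun o => o.elim (X none) fun i => ∑ j, C (c i j) * X (some j)

theorem linHomOption_X_some (c : κ → σ → ℂ) (i : κ) :
    linHomOption c (X (some i)) = ∑ j, C (c i j) * X (some j) := by simp [linHomOption]

@[simp]
theorem linHomOption_X_none (c : κ → σ → ℂ) : linHomOption c (X none) = X none := by
  simp [linHomOption]

theorem scaleHom_linHomOption (c : κ → σ → ℂ) (g : MvPolynomial (Option κ) ℂ) :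
    scaleHom σ (linHomOption c g) = (scaleHom κ g).map (linHom c).toRingHom := by
  have : (scaleHom σ).comp (linHomOption c) =
      (Polynomial.mapAlgHom (linHom c)).comp (scaleHom κ) := by
    ext1 o
    cases o with
    | none => simp
    | some i =>
      have hC (z : ℂ) : scaleHom σ (C z) = Polynomial.C (C z) := (scaleHom σ).commutes z
      simp only [AlgHom.comp_apply, linHomOption_X_some, map_sum, map_mul, scaleHom_X_some, hC,
        Polynomial.coe_mapAlgHom, Polynomial.map_C, Polynomial.map_X]
      simp only [linHom, RingHom.coe_coe, aeval_X, map_sum, map_mul,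
        Finset.sum_mul, mul_assoc]
  exact DFunLike.congr_fun this g

theorem dehomogHom_linHomOption (c : κ → σ → ℂ) (s : ℂ) (g : MvPolynomial (Option κ) ℂ) :
    dehomogHom σ s (linHomOption c g) = linHom c (dehomogHom κ s g) := by
  have : (dehomogHom σ s).comp (linHomOption c) = (linHom c).comp (dehomogHom κ s) := by
    ext1 o
    have hC (z : ℂ) : dehomogHom σ s (C z) = C z := (dehomogHom σ s).commutes z
    have hC' (z : ℂ) : linHom c (C z) = C z := (linHom c).commutes z
    cases o with
    | none =>
      rw [AlgHom.comp_apply, AlgHom.comp_apply, linHomOption_X_none]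
      simp [dehomogHom, hC']
    | some i =>
      rw [AlgHom.comp_apply, linHomOption_X_some]
      simp only [map_sum, map_mul, hC]
      simp [dehomogHom, linHom]
  exact DFunLike.congr_fun this g

/-- The morphism induced by linear forms on the homogenised coordinate ring. -/
noncomputable def linQuotient (I : Ideal (MvPolynomial σ ℂ)) (c : κ → σ → ℂ) :
    MvPolynomial (Option κ) ℂ →ₐ[ℂ] MvPolynomial (Option σ) ℂ ⧸ homogIdeal I :=
  (Ideal.Quotient.mkₐ ℂ (homogIdeal I)).comp (linHomOption c)

/-- Each coefficient in `s` of a homogenised relation is a relation between the forms modulo `I`. -/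
theorem linQuotient_injective [Finite κ] {I : Ideal (MvPolynomial σ ℂ)} {c : κ → σ → ℂ}
    (h : ∀ p, linHom c p ∈ I → p = 0) : Function.Injective (linQuotient I c) := by
  rw [injective_iff_map_eq_zero]
  intro g hg
  have hg' : linHomOption c g ∈ homogIdeal I := Ideal.Quotient.eq_zero_iff_mem.1 hg
  rw [mem_homogIdeal, scaleHom_linHomOption] at hg'
  apply scaleHom_injective
  ext1 k
  rw [map_zero, Polynomial.coeff_zero]
  exact h _ (by simpa using hg' k)

theorem eq_zero_of_linHom_mem {I : Ideal (MvPolynomial σ ℂ)} (hI : I ≠ ⊤) {c : κ → σ → ℂ}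
    {p : MvPolynomial κ ℂ} {z : ℂ} (hp : p = C z) (hpI : linHom c p ∈ I) : p = 0 := by
  subst hp
  have hC : linHom c (C z) = C z := (linHom c).commutes _
  rw [hC] at hpI
  by_contra h
  have hu : IsUnit (C z : MvPolynomial σ ℂ) :=
    (isUnit_iff_ne_zero.2 fun h' => h (by simp [h'])).map C
  exact hI (Ideal.eq_top_of_isUnit_mem _ hpI hu)

theorem homogeneousComponent_totalDegree_ne_zero {p : MvPolynomial κ ℂ} (hp : p ≠ 0) :
    homogeneousComponent p.totalDegree p ≠ 0 := by
  obtain ⟨d, hd, hdeg⟩ := Finset.exists_mem_eq_sup p.support (support_nonempty.2 hp)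
    fun s => s.sum fun _ e => e
  intro h
  have := congrArg (coeff d) h
  rw [coeff_homogeneousComponent, if_pos (show Finsupp.degree d = p.totalDegree from hdeg.symm), coeff_zero] at this
  exact mem_support_iff.1 hd this

/-- A relation between the linear forms `c` modulo `I` allows to replace them by fewer forms. -/
theorem exists_isIntegralElem_linQuotient {I : Ideal (MvPolynomial σ ℂ)} (hI : I ≠ ⊤) {d : ℕ}
    (c : Fin (d + 1) → σ → ℂ) {p : MvPolynomial (Fin (d + 1)) ℂ} (hp : p ≠ 0)
    (hpI : linHom c p ∈ I) :
    ∃ c' : Fin d → σ → ℂ, ∀ i,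
      (linQuotient I c').toRingHom.IsIntegralElem (linQuotient I c (X i)) := by
  set k := p.totalDegree
  have hk : k ≠ 0 := by
    intro hk
    exact hp (eq_zero_of_linHom_mem hI (totalDegree_eq_zero_iff_eq_C.1 hk) hpI)
  have htop := homogeneousComponent_totalDegree_ne_zero hp
  obtain ⟨a, ha⟩ : ∃ a, eval a (homogeneousComponent k p) ≠ 0 := by
    by_contra! h
    exact htop (MvPolynomial.funext fun x => by simpa using h x)
  obtain ⟨i₀, hi₀⟩ : ∃ i, a i ≠ 0 := by
    by_contra! h
    have h0 : a = 0 := _root_.funext h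
    have hhom := homogeneousComponent_isHomogeneous k p
    rw [h0, eval_zero, constantCoeff_eq] at ha
    have := hhom ha
    simp at this
    exact hk this.symm
  -- Coordinates adapted to the direction `a`: with `T` the form `c i₀` divided by `a i₀`, each old
  -- form is `e i + a i * T`, where `e i₀ = 0` and the other `e i` are the new forms.
  let c' (j : Fin d) : σ → ℂ := c (i₀.succAbove j) - (a (i₀.succAbove j) / a i₀) • c i₀
  let T : MvPolynomial (Option σ) ℂ := C (a i₀)⁻¹ * linHomOption c (X (some i₀))
  let e : Fin (d + 1) → MvPolynomial (Option (Fin d)) ℂ :=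
    i₀.insertNth 0 fun j => X (some j)
  let L (i : Fin (d + 1)) : Polynomial (MvPolynomial (Option (Fin d)) ℂ) :=
    Polynomial.C (e i) + Polynomial.C (C (a i)) * Polynomial.X
  have hCc' (z : ℂ) : linHomOption c' (C z) = C z := (linHomOption c').commutes z
  have hL (i) : (L i).eval₂ (linHomOption c').toRingHom T = linHomOption c (X (some i)) := by
    have h1 : (L i).eval₂ (linHomOption c').toRingHom T =
        linHomOption c' (e i) + C (a i) * T := by simp [L, hCc']
    rw [h1]
    obtain rfl | ⟨j, rfl⟩ := i₀.eq_self_or_eq_succAbove i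
    · simp only [e, T, Fin.insertNth_apply_same, map_zero, zero_add, ← mul_assoc, ← C_mul]
      rw [mul_inv_cancel₀ hi₀, C_1, one_mul]
    · simp only [e, T, Fin.insertNth_apply_succAbove, linHomOption_X_some, Finset.mul_sum,
        ← Finset.sum_add_distrib]
      refine Finset.sum_congr rfl fun l _ => ?_
      simp only [c', Pi.sub_apply, Pi.smul_apply, smul_eq_mul, div_eq_mul_inv, C_sub, C_mul]
      ring
  -- The homogenised relation as a polynomial in `T`. Components of degree `m < k` have degree at
  -- most `m` in `T`, so the coefficient of `T ^ k` is the nonzero constant `p_k(a)`, with `p_k` the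
  -- top component.
  let Q : Polynomial (MvPolynomial (Option (Fin d)) ℂ) :=
    aeval (fun o : Option (Fin (d + 1)) => o.elim (Polynomial.C (X none)) L) (homogenization p)
  have hQT : Q.eval₂ (linHomOption c').toRingHom T = linHomOption c (homogenization p) := by
    have : ((Polynomial.eval₂RingHom (linHomOption c').toRingHom T).comp
        (aeval (fun o : Option (Fin (d + 1)) =>
          o.elim (Polynomial.C (X none)) L)).toRingHom) = (linHomOption c).toRingHom := by
      apply ringHom_ext
      · intro z
        have hCc (z : ℂ) : linHomOption c (C z) = C z := (linHomOption c).commutes z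
        have hz : (algebraMap ℂ (Polynomial (MvPolynomial (Option (Fin d)) ℂ))) z =
          Polynomial.C (C z) := rfl
        simp [hCc', hCc, hz]
      · intro o
        cases o with
        | none => simp
        | some i => simpa using hL i
    exact DFunLike.congr_fun this _
  have hQ : Q = ∑ m ∈ Finset.range (k + 1),
      Polynomial.C (X none ^ (k - m)) * aeval L (homogeneousComponent m p) := by
    simp only [Q, homogenization, map_sum, map_mul, map_pow, aeval_X, aeval_rename,
      Option.elim_none]
    rfl
  have hLhom (m : ℕ) := natDegree_aeval_le_and_coeff (homogeneousComponent_isHomogeneous m p) L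
    (fun i => by
      simp only [L]
      exact Polynomial.natDegree_add_le_of_degree_le (by simp)
        ((Polynomial.natDegree_C_mul_le _ _).trans Polynomial.natDegree_X_le)) a
    (fun i => by simp [L, Polynomial.coeff_C])
  have hQdeg : Q.natDegree ≤ k := by
    rw [hQ]
    exact Polynomial.natDegree_sum_le_of_forall_le _ _ fun m hm =>
      (Polynomial.natDegree_C_mul_le _ _).trans
        ((hLhom m).1.trans (Finset.mem_range_succ_iff.1 hm))
  have hQk : Q.coeff k = C (eval a (homogeneousComponent k p)) := by
    rw [hQ, Polynomial.finsetSum_coeff, Finset.sum_range_succ, Finset.sum_eq_zero, zero_add]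
    · rw [Polynomial.coeff_C_mul, (hLhom k).2]
      simp
    · intro m hm
      rw [Polynomial.coeff_C_mul, Polynomial.coeff_eq_zero_of_natDegree_lt
        ((hLhom m).1.trans_lt (Finset.mem_range.1 hm)), mul_zero]
  have hT : (linQuotient I c').toRingHom.IsIntegralElem (Ideal.Quotient.mk _ T) := by
    refine ⟨Polynomial.C (C (eval a (homogeneousComponent k p))⁻¹) * Q,
      Polynomial.monic_of_natDegree_le_of_coeff_eq_one k
        ((Polynomial.natDegree_C_mul_le _ _).trans hQdeg) ?_, ?_⟩
    · rw [Polynomial.coeff_C_mul, hQk, ← C_mul, inv_mul_cancel₀ ha, C_1]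
    · have h1 : (linQuotient I c').toRingHom =
        (Ideal.Quotient.mk (homogIdeal I)).comp (linHomOption c').toRingHom := rfl
      rw [Polynomial.eval₂_mul, h1, ← Polynomial.hom_eval₂ Q, hQT]
      have : linHomOption c (homogenization p) ∈ homogIdeal I := by
        rw [mem_homogIdeal]
        intro m
        rw [scaleHom_linHomOption, scaleHom_homogenization, Polynomial.coeff_map,
          Polynomial.coeff_X_pow_mul', Polynomial.coeff_C]
        split_ifs
        · exact hpI
        · simp
        · simp
      rw [Ideal.Quotient.eq_zero_iff_mem.2 this, mul_zero]
  refine ⟨c', fun o => ?_⟩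
  cases o with
  | none =>
    have : linQuotient I c (X none) = (linQuotient I c').toRingHom (X none) := by
      simp [linQuotient]
    rw [this]
    exact RingHom.isIntegralElem_map _
  | some i =>
    have : linQuotient I c (X (some i)) = (linQuotient I c').toRingHom (e i) +
        (linQuotient I c').toRingHom (C (a i)) * Ideal.Quotient.mk _ T := by
      have h2 : linQuotient I c (X (some i)) =
        Ideal.Quotient.mk _ (linHomOption c (X (some i))) := rfl
      have h3 : (linQuotient I c').toRingHom (C (a i)) = Ideal.Quotient.mk _ (C (a i)) :=
        congrArg (Ideal.Quotient.mk _) (hCc' (a i))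
      rw [h2, ← hL, h3]
      simp [L, linQuotient, hCc']
    rw [this]
    exact (RingHom.isIntegralElem_map _).add _ ((RingHom.isIntegralElem_map _).mul _ hT)

/-- Noether normalisation by linear forms, compatible with the homogenisation. -/
theorem exists_linear_noether_normalization {n : ℕ} {I : Ideal (MvPolynomial (Fin n) ℂ)}
    (hI : I ≠ ⊤) :
    ∃ (d : ℕ) (c : Fin d → Fin n → ℂ), Function.Injective (linQuotient I c) ∧
      (linQuotient I c).toRingHom.IsIntegral := by
  classical
  have hex : ∃ (d : ℕ) (c : Fin d → Fin n → ℂ), (linQuotient I c).toRingHom.IsIntegral := by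
    refine ⟨n, fun i j => if i = j then 1 else 0, RingHom.isIntegral_of_surjective _ ?_⟩
    have : linHomOption (fun i j : Fin n => if i = j then (1 : ℂ) else 0) = AlgHom.id ℂ _ := by
      ext1 o
      cases o with
      | none => simp
      | some i => simp [linHomOption_X_some, apply_ite C]
    rw [linQuotient, this]
    exact Ideal.Quotient.mk_surjective
  -- With the number of forms minimal, a nontrivial relation would allow one form fewer.
  obtain ⟨d, ⟨c, hc⟩, hmin⟩ : ∃ d, (∃ c : Fin d → Fin n → ℂ,
      (linQuotient I c).toRingHom.IsIntegral) ∧ ∀ m < d, ¬ ∃ c : Fin m → Fin n → ℂ,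
      (linQuotient I c).toRingHom.IsIntegral :=
    ⟨Nat.find hex, Nat.find_spec hex, fun m => Nat.find_min hex⟩
  refine ⟨d, c, linQuotient_injective fun p hpI => ?_, hc⟩
  cases d with
  | zero => exact eq_zero_of_linHom_mem hI (eq_C_of_isEmpty p) hpI
  | succ d =>
    by_contra hp
    obtain ⟨c', hc'⟩ := exists_isIntegralElem_linQuotient hI c hp hpI
    exact hmin d d.lt_succ_self ⟨c', isIntegral_of_forall_isIntegralElem hc hc'⟩

end MvPolynomial

/-! ### Dimension of the slices. -/

namespace MvPolynomial

variable {κ σ : Type*}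

theorem dehomogHom_rename_some (s : ℂ) (p : MvPolynomial σ ℂ) :
    dehomogHom σ s (rename some p) = p := by
  rw [dehomogHom, aeval_rename]
  exact aeval_X_left_apply p

variable [Fintype σ]

/-- Lying over gives a point above `(s, w)`; it has height `s` because the homogenising variable is
fixed. -/
theorem exists_mem_slice_of_isIntegral {I : Ideal (MvPolynomial σ ℂ)} {c : κ → σ → ℂ}
    (hinj : Function.Injective (linQuotient I c))
    (hint : (linQuotient I c).toRingHom.IsIntegral) (s : ℂ) (w : κ → ℂ) :
    ∃ v ∈ slice I s, ∀ p, aeval v (linHom c p) = eval w p := by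
  obtain ⟨x, hx, hxw⟩ := exists_mem_zeroLocus_of_isIntegral (homogIdeal I)
    (linQuotient I c).toRingHom hint (eval fun o : Option κ => o.elim s w)
    (fun z => ⟨C z, by simp⟩)
    (by rw [(RingHom.injective_iff_ker_eq_bot (linQuotient I c).toRingHom).1 hinj]; exact bot_le)
    (fun z => ⟨C z, by simp, (linQuotient I c).commutes z⟩)
  replace hxw (r) : eval (fun o : Option κ => o.elim s w) r = aeval x (linHomOption c r) :=
    hxw r _ rfl
  have hxs : (fun o : Option σ => o.elim s fun i => x (some i)) = x := by
    funext o
    cases o with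
    | none => simpa using hxw (X none)
    | some i => rfl
  refine ⟨fun i => x (some i), ?_, fun p => ?_⟩
  · rw [slice, Set.mem_ofPred_eq, hxs]
    exact hx
  · have h2 := hxw (rename some p)
    rw [← hxs, ← aeval_dehomogHom, dehomogHom_linHomOption,
      dehomogHom_rename_some] at h2
    rw [← h2, eval_rename]
    rfl

/-- The right-hand side does not involve `s`, so heights `1` and `0` give the same dimension.
Integrality passes to the slice, and injectivity follows from surjectivity on points. -/
theorem ringKrullDim_quotient_vanishingIdeal_slice {I : Ideal (MvPolynomial σ ℂ)}
    {c : κ → σ → ℂ} (hinj : Function.Injective (linQuotient I c))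
    (hint : (linQuotient I c).toRingHom.IsIntegral) (s : ℂ) :
    ringKrullDim (MvPolynomial σ ℂ ⧸ vanishingIdeal ℂ (slice I s)) =
      ringKrullDim (MvPolynomial κ ℂ) := by
  set J := vanishingIdeal ℂ (slice I s)
  apply ringKrullDim_eq_of_isIntegral_of_injective
    ((Ideal.Quotient.mk J).comp (linHom c).toRingHom)
  · let D : MvPolynomial (Option σ) ℂ ⧸ homogIdeal I →+* MvPolynomial σ ℂ ⧸ J :=
      Ideal.Quotient.lift _ ((Ideal.Quotient.mk J).comp (dehomogHom σ s).toRingHom) fun g hg =>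
        Ideal.Quotient.eq_zero_iff_mem.2 fun v hv => by
          rw [AlgHom.toRingHom_eq_coe, RingHom.coe_coe, aeval_dehomogHom]
          exact hv g hg
    have hD : Function.Surjective D := by
      intro y
      obtain ⟨p, rfl⟩ := Ideal.Quotient.mk_surjective y
      refine ⟨Ideal.Quotient.mk _ (rename some p), ?_⟩
      simp [D, dehomogHom_rename_some]
    -- On the slice `s` is constant, so integrality over the ring with `s` gives integrality over
    -- the ring without it.
    apply RingHom.IsIntegral.tower_top (dehomogHom κ s).toRingHom
    have hcomm : ((Ideal.Quotient.mk J).comp (linHom c).toRingHom).comp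
        (dehomogHom κ s).toRingHom = D.comp (linQuotient I c).toRingHom := by
      refine RingHom.ext fun g => ?_
      exact congrArg (Ideal.Quotient.mk J) (dehomogHom_linHomOption c s g).symm
    rw [hcomm]
    exact RingHom.IsIntegral.trans _ _ hint (RingHom.isIntegral_of_surjective _ hD)
  · rw [injective_iff_map_eq_zero]
    intro p hp
    apply MvPolynomial.funext
    intro w
    obtain ⟨v, hv, hvw⟩ := exists_mem_slice_of_isIntegral hinj hint s w
    rw [map_zero, ← hvw]
    exact Ideal.Quotient.eq_zero_iff_mem.1 hp v hv

end MvPolynomial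

/-! ### The tangent cone is the slice at height zero. -/

theorem tendsto_ofReal_one_div_atTop_zero {t : ℕ → ℝ} (ht : Tendsto t atTop atTop) :
    Tendsto (fun j => ((1 / t j : ℝ) : ℂ)) atTop (𝓝 0) := by
  have := (Complex.continuous_ofReal.tendsto 0).comp (tendsto_inv_atTop_zero.comp ht)
  simpa [Function.comp_def] using this

open MvPolynomial

theorem tangentConeAtInfinity_zeroLocus_subset {n : ℕ} (I : Ideal (MvPolynomial (Fin n) ℂ))
    {t : ℕ → ℝ} (ht : Tendsto t atTop atTop) :
    tangentConeAtInfinity t (zeroLocus ℂ I) ⊆ slice I 0 := by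
  rintro v ⟨x, hx, hlim⟩
  have h0 := tendsto_ofReal_one_div_atTop_zero ht
  have hlim' : Tendsto (fun j => fun o : Option (Fin n) => o.elim ((1 / t j : ℝ) : ℂ)
      (((1 / t j : ℝ) : ℂ) • x j)) atTop (𝓝 fun o => o.elim 0 v) := by
    rw [tendsto_pi_nhds]
    intro o
    cases o with
    | none => exact h0
    | some i => simpa using (tendsto_pi_nhds.1 hlim) i
  exact (isClosed_zeroLocus (homogIdeal I)).mem_of_tendsto hlim'
    (Eventually.of_forall fun j => elim_smul_mem_zeroLocus (hx j) _)

theorem slice_zero_subset_tangentConeAtInfinity {n : ℕ} {I : Ideal (MvPolynomial (Fin n) ℂ)}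
    (hI : I.IsRadical) {t : ℕ → ℝ} (ht₀ : ∀ j, 0 < t j) (ht : Tendsto t atTop atTop) :
    slice I 0 ⊆ tangentConeAtInfinity t (zeroLocus ℂ I) := by
  intro v hv
  obtain ⟨P, hP, hvP⟩ := exists_minimalPrimes_mem_slice hI hv
  have : P.IsPrime := hP.1.1
  obtain ⟨d, c, hinj, hint⟩ := exists_linear_noether_normalization this.ne_top
  have h0 := tendsto_ofReal_one_div_atTop_zero ht
  set x₀ : Option (Fin n) → ℂ := fun o => o.elim 0 v
  let y (i : Fin d) : ℂ := aeval x₀ (linHomOption c (X (some i)))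
  -- The base point moves only in the `s` direction, with the values `y` of the forms at `v` kept
  -- fixed.
  obtain ⟨x, hx, hxw, hxlim⟩ := exists_tendsto_mem_zeroLocus (homogIdeal P) (linHomOption c)
    hint hinj (x₀ := x₀) hvP
    (w := fun j => fun o : Option (Fin d) => o.elim ((1 / t j : ℝ) : ℂ) y)
    (w₀ := fun o => o.elim 0 y)
    (by
      rw [tendsto_pi_nhds]
      intro o
      cases o with
      | none => exact h0
      | some i => exact tendsto_const_nhds)
    (by
      intro o
      cases o with
      | none => simp [x₀]
      | some i => rfl)
  have ht' (j : ℕ) : ((1 / t j : ℝ) : ℂ) ≠ 0 := by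
    exact_mod_cast (one_div_pos.2 (ht₀ j)).ne'
  have hxnone (j : ℕ) : x j none = ((1 / t j : ℝ) : ℂ) := by
    simpa using hxw j none
  let u (j : ℕ) : Fin n → ℂ := ((1 / t j : ℝ) : ℂ)⁻¹ • fun i => x j (some i)
  have hu (j : ℕ) : ((1 / t j : ℝ) : ℂ) • u j = fun i => x j (some i) :=
    smul_inv_smul₀ (ht' j) _
  refine ⟨u, fun j => zeroLocus_anti_mono hP.1.2 (mem_zeroLocus_of_elim_smul (ht' j) ?_), ?_⟩
  · have : (fun o : Option (Fin n) => o.elim ((1 / t j : ℝ) : ℂ)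
        (((1 / t j : ℝ) : ℂ) • u j)) = x j := by
      rw [hu]
      funext o
      cases o with
      | none => exact (hxnone j).symm
      | some i => rfl
    rw [this]
    exact hx j
  · have hu' (j : ℕ) : (1 / t j) • u j = fun i => x j (some i) := hu j
    simp only [hu']
    rw [tendsto_pi_nhds] at hxlim ⊢
    exact fun i => hxlim (some i)

theorem proposition2p10 {n : ℕ} (V : Set (Fin n → ℂ)) (hV : IsComplexAlgebraicSet V)
    (hunb : ¬ Bornology.IsBounded V) :
    ∃ C : Set (Fin n → ℂ), IsTheTangentConeAtInfinity V C ∧ IsComplexAlgebraicSet C ∧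
      algebraicSetDim V = algebraicSetDim C := by
  obtain ⟨I₀, rfl⟩ := hV
  set I := I₀.radical
  have hzero : zeroLocus ℂ I₀ = zeroLocus ℂ I := by
    refine Set.Subset.antisymm (fun x hx p hp => ?_) (zeroLocus_anti_mono Ideal.le_radical)
    exact radical_le_vanishingIdeal_zeroLocus I₀ hp x hx
  rw [hzero] at hunb ⊢
  -- Unboundedness enters only through nonemptiness of the zero locus.
  have hI : I ≠ ⊤ := by
    rintro h
    rw [h, zeroLocus_top] at hunb
    exact hunb Bornology.isBounded_empty
  obtain ⟨d, c, hinj, hint⟩ := exists_linear_noether_normalization hI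
  refine ⟨slice I 0, fun t ht₀ ht => ?_, ⟨_, slice_eq_zeroLocus I 0⟩, ?_⟩
  · exact (tangentConeAtInfinity_zeroLocus_subset I ht).antisymm
      (slice_zero_subset_tangentConeAtInfinity I₀.radical_isRadical ht₀ ht)
  · rw [← slice_one, algebraicSetDim, algebraicSetDim,
      ringKrullDim_quotient_vanishingIdeal_slice hinj hint,
      ringKrullDim_quotient_vanishingIdeal_slice hinj hint]
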